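/- Let $(\Omega,\mathcal F,\mathrm p)$ be a probability space, let $d\in\mathbb N$ and let $M:\Omega\to M_d(\mathbb C)$ be a measurable map which is a random reduced dynamics operator: there are a norm $|||\cdot|||$ on $\mathbb C^d$ with $|||M(\omega)v|||\le|||v|||$ for all $\omega\in\Omega$, $v\in\mathbb C^d$, and a vector $\psi_S\in\mathbb C^d$, independent of $\omega$, with Euclidean norm $\|\psi_S\|=1$ and $M(\omega)\psi_S=\psi_S$ for all $\omega$. Let $\mathcal M_{(E)}$ be the set of matrices whose spectrum on the complex unit circle consists only of the eigenvalue $1$, and for which this eigenvalue is simple. Let $\mathbb P=\mathrm p^{\otimes\mathbb N^*}$ be the product measure on $\Omega^{\mathbb N^*}$, and for $\overline\omega=(\omega_1,\omega_2,\dots)$ put $$\Phi_n(\overline\omega)=M(\omega_n)\cdots M(\omega_1),\qquad \Psi_n(\overline\omega)=M(\omega_1)\cdots M(\omega_n).$$ For a sequence $A=(A_n)$ of $d\times d$ matrices let $s_1(A_n)\ge\dots\ge s_d(A_n)\ge 0$ be the singular values of $A_n$, so that $s_i(A_n)^{1/n}$ are the eigenvalues of $(A_n^*A_n)^{1/2n}$.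 The Lyapunov exponents of $A$ are $\gamma_i=\limsup_{n\to\infty}\frac1n\log s_i(A_n)\in[-\infty,\infty]$, $i=1,\dots,d$; $\gamma_1$ is the top one, and its multiplicity is the number of $i\in\{1,\dots,d\}$ with $\gamma_i=\gamma_1$. Suppose that $\mathrm p(M(\omega)\in\mathcal M_{(E)})>0$. Then there exist $\alpha>0$, a random vector (measurable map) $\eta_\infty:\Omega^{\mathbb N^*}\to\mathbb C^d$ and a measurable set $\Omega_0\subset\Omega^{\mathbb N^*}$ with $\mathbb P(\Omega_0)=1$ such that for every $\overline\omega\in\Omega_0$: 1. there is a constant $C_{\overline\omega}$ such that for all $n\in\mathbb N^*$ $$\big\|\Phi_n(\overline\omega)-|\psi_S\rangle\langle\eta_\infty(\overline\omega)|\big\|\le C_{\overline\omega}e^{-\alpha n},$$ where $|\psi\rangle\langle\phi|$ is the operator $\chi\mapsto\langle\phi,\chi\rangle\psi$ (the inner product being linear in the second factor) and $\|\cdot\|$ is the operator norm for the Euclidean norm; 2. for each of the sequences $\Phi_n(\overline\omega)$ and $\Psi_n(\overline\omega)$, the top Lyapunov exponent $\gamma_1(\overline\omega)$ is the limit $\lim_{n\to\infty}\frac1n\log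 s_1$, it equals $0$, and it has multiplicity one; 3. whenever $\Lambda=\lim_{n\to\infty}(\Phi_n(\overline\omega)^*\Phi_n(\overline\omega))^{1/2n}$ exists, the largest eigenvalue of $\Lambda$ is $e^{\gamma_1(\overline\omega)}=1$, and it is simple. -/

import Mathlib

open MeasureTheory Filter Topology

noncomputable section

/-- The space `ℂ^d` with its Euclidean norm; `Op d` is the algebra of its linear operators, with
the operator norm. -/
abbrev Vec (d : ℕ) : Type := EuclideanSpace ℂ (Fin d)

abbrev Op (d : ℕ) : Type := Vec d →L[ℂ] Vec d

/-- `M` is a random reduced dynamics operator on `ℂ^d` with (normalized, deterministic) invariant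
vector `ψS`: it is a measurable map into the operators on `ℂ^d`, all its values fix `ψS`, and
all its values are contractions for one and the same norm `N` on `ℂ^d`
(a norm is a seminorm that vanishes only at `0`). -/
structure IsRRDO {Ω : Type*} [MeasurableSpace Ω] {d : ℕ} (M : Ω → Op d) (ψS : Vec d) : Prop where
  measurable : Measurable M
  exists_norm : ∃ N : Seminorm ℂ (Vec d), (∀ v, N v = 0 → v = 0) ∧ ∀ ω v, N (M ω v) ≤ N v
  fixed : ∀ ω, M ω ψS = ψS
  norm_eq_one : ‖ψS‖ = 1

/-- The operators whose spectrum on the complex unit circle consists only of the eigenvalue `1`,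
and for which `1` is simple, i.e. of algebraic multiplicity one. -/
def ME (d : ℕ) : Set (Op d) :=
  {A | spectrum ℂ A ∩ Metric.sphere (0 : ℂ) 1 = {1} ∧
    Module.finrank ℂ (Module.End.maxGenEigenspace (A : Vec d →ₗ[ℂ] Vec d) 1) = 1}

/-- The law of an i.i.d. sequence `(ω₁, ω₂, …)` with common law `p`; `ω_{j+1}` is `ω j`. -/
def iidMeasure {Ω : Type*} [MeasurableSpace Ω] (p : Measure Ω) [IsProbabilityMeasure p] :
    Measure (ℕ → Ω) :=
  Measure.infinitePi (fun _ : ℕ => p)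

/-- `Phi M ω n = M(ω_n) ⋯ M(ω_1)`. -/
def Phi {Ω : Type*} {d : ℕ} (M : Ω → Op d) (ω : ℕ → Ω) : ℕ → Op d
  | 0 => 1
  | n + 1 => M (ω n) * Phi M ω n

/-- `Psi M ω n = M(ω_1) ⋯ M(ω_n)`. -/
def Psi {Ω : Type*} {d : ℕ} (M : Ω → Op d) (ω : ℕ → Ω) : ℕ → Op d
  | 0 => 1
  | n + 1 => Psi M ω n * M (ω n)

/-- The `i`-th singular value (`i = 0` is the largest; they are repeated with multiplicity), i.e.
the `i`-th eigenvalue of `(A* A)^{1/2}`. -/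
def singVal {d : ℕ} (A : Op d) (i : ℕ) : ℝ :=
  (A : Vec d →ₗ[ℂ] Vec d).singularValues i

/-- The `i`-th Lyapunov exponent of the sequence `A n`, namely
`limsup (1/n) log s_i(A n)`, the logarithm of the upper limit of the `i`-th eigenvalue of
`(A n* A n)^{1/2n}`. It lies in `[-∞, ∞]`. -/
def lyapunovExponent {d : ℕ} (A : ℕ → Op d) (i : ℕ) : EReal :=
  limsup (fun n : ℕ => ENNReal.log (ENNReal.ofReal (singVal (A n) i)) / (n : EReal)) atTop

/-- The multiplicity of the top Lyapunov exponent: how many of the `d` Lyapunov exponents are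
equal to it. -/
def topLyapunovMultiplicity {d : ℕ} (A : ℕ → Op d) : ℕ :=
  Set.ncard {i : ℕ | i < d ∧ lyapunovExponent A i = lyapunovExponent A 0}

/-- `(A n* A n)^{1/2n}`, where the real power of a nonnegative operator is the one of the
continuous functional calculus. -/
def absRoot {d : ℕ} (A : ℕ → Op d) (n : ℕ) : Op d :=
  (star (A n) * A n) ^ (1 / (2 * (n : ℝ)))

end

/-! All factors fix `ψS`, so they act on the quotient by the line it spans. There they are
contractions for the quotient gauge `g` of the common norm, and `g v` is comparable to `‖projCompl
ψS v‖`. If `M ω₀` lies in `ME d`, its action on the quotient has spectral radius below 1, so a power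
of it contracts strongly. By continuity so does any product of `k` factors close to `M ω₀`, in
either order (`exists_contracting_set`). Disjoint blocks of `k` factors are independent, and each is
contracting with one fixed positive probability. Hence almost surely `g` decays exponentially along
both `Phi` and `Psi` (`exists_ae_norm_projCompl_mul_le`).

The rest is deterministic. With `Q = projCompl ψS`, `Phi n` is `Q * Phi n` plus the rank-one
operator of `ψS` and the adjoint image of `ψS`. These images form a Cauchy sequence, with limit `η`.
Fixing `ψS` and uniform boundedness keep the top singular value between 1 and a constant, while
min-max bounds the second one by the norm of `Q` times the product. This separates the top Lyapunov
exponent, and likewise the eigenvalue 1 of `Λ`. -/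

noncomputable section

/-! ### Projection off the invariant vector, the quotient gauge, and the spectral gap -/

/-- The orthogonal projection onto the complement of a unit vector `ψ`. -/
def projCompl {d : ℕ} (ψ : Vec d) : Op d := 1 - InnerProductSpace.rankOne ℂ ψ ψ

variable {d : ℕ}

theorem projCompl_apply (ψ v : Vec d) : projCompl ψ v = v - inner ℂ ψ v • ψ := by
  simp [projCompl]

theorem projCompl_self {ψ : Vec d} (hψ : ‖ψ‖ = 1) : projCompl ψ ψ = 0 := by
  rw [projCompl_apply, inner_self_eq_norm_sq_to_K, hψ]; simp

theorem projCompl_add_smul {ψ : Vec d} (hψ : ‖ψ‖ = 1) (v : Vec d) (c : ℂ) :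
    projCompl ψ (v + c • ψ) = projCompl ψ v := by
  rw [map_add, map_smul, projCompl_self hψ]; simp

theorem inner_projCompl {ψ : Vec d} (hψ : ‖ψ‖ = 1) (v : Vec d) :
    inner ℂ ψ (projCompl ψ v) = 0 := by
  rw [projCompl_apply, inner_sub_right, inner_smul_right, inner_self_eq_norm_sq_to_K, hψ]; simp

theorem norm_projCompl_apply_le {ψ : Vec d} (hψ : ‖ψ‖ = 1) (v : Vec d) :
    ‖projCompl ψ v‖ ≤ ‖v‖ := by
  have h : v = inner ℂ ψ v • ψ + projCompl ψ v := by rw [projCompl_apply]; abel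
  have h2 := norm_add_sq_eq_norm_sq_add_norm_sq_of_inner_eq_zero (inner ℂ ψ v • ψ)
    (projCompl ψ v) (by rw [inner_smul_left, inner_projCompl hψ, mul_zero])
  rw [← h] at h2
  nlinarith [norm_nonneg v, norm_nonneg (projCompl ψ v), mul_self_nonneg ‖inner ℂ ψ v • ψ‖]

theorem projCompl_of_inner_eq_zero {ψ v : Vec d} (h : inner ℂ ψ v = 0) :
    projCompl ψ v = v := by
  rw [projCompl_apply, h]; simp

theorem projCompl_apply_projCompl {ψ : Vec d} (hψ : ‖ψ‖ = 1) {T : Op d} (hT : T ψ = ψ)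
    (v : Vec d) : projCompl ψ (T (projCompl ψ v)) = projCompl ψ (T v) := by
  rw [projCompl_apply ψ v, map_sub, map_smul, hT, map_sub, map_smul, projCompl_self hψ]; simp

/-- On a finite-dimensional space, a seminorm vanishing only at `0` is equivalent to the norm. -/
theorem Seminorm.equiv_norm_of_definite [Nontrivial (Vec d)] (N : Seminorm ℂ (Vec d))
    (hN : ∀ v, N v = 0 → v = 0) :
    ∃ a b : ℝ, 0 < a ∧ 0 < b ∧ ∀ v, a * ‖v‖ ≤ N v ∧ N v ≤ b * ‖v‖ := by
  have hle : ∀ v, N v ≤ (∑ i, N (EuclideanSpace.basisFun (Fin d) ℂ i)) * ‖v‖ := by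
    intro v
    conv_lhs => rw [← (EuclideanSpace.basisFun (Fin d) ℂ).sum_repr v]
    refine (Finset.le_sum_of_subadditive N (map_zero N).le (map_add_le_add N) _ _).trans ?_
    rw [Finset.sum_mul]
    refine Finset.sum_le_sum fun i _ => ?_
    rw [map_smul_eq_mul, mul_comm]
    refine mul_le_mul_of_nonneg_left ?_ (apply_nonneg N _)
    simpa using PiLp.norm_apply_le v i
  have hcont : Continuous N := by
    refine Seminorm.continuous_of_continuousAt_zero ?_
    rw [ContinuousAt, map_zero]
    refine squeeze_zero (fun v => apply_nonneg N v) hle ?_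
    exact Continuous.tendsto' (by fun_prop) _ _ (by simp)
  obtain ⟨x, hx, hmin⟩ := (isCompact_sphere (0 : Vec d) 1).exists_isMinOn
    (NormedSpace.sphere_nonempty.2 zero_le_one) hcont.continuousOn
  have hx1 : ‖x‖ = 1 := by simpa using hx
  have hNx : 0 < N x := lt_of_le_of_ne (apply_nonneg N x) fun h => by
    rw [hN x h.symm] at hx1; simp at hx1
  refine ⟨N x, ∑ i, N (EuclideanSpace.basisFun (Fin d) ℂ i), hNx, ?_, fun v => ⟨?_, hle v⟩⟩
  · have := hle x
    rw [hx1, mul_one] at this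
    exact hNx.trans_le this
  · rcases eq_or_ne v 0 with rfl | hv
    · simp
    have hv' : 0 < ‖v‖ := norm_pos_iff.2 hv
    have h1 := hmin (a := ((‖v‖⁻¹ : ℝ) : ℂ) • v) (by
      simp [norm_smul, hv'.ne'])
    simp only [Set.mem_ofPred_eq, map_smul_eq_mul, Complex.norm_real, norm_inv, norm_norm] at h1
    rwa [inv_mul_eq_div, le_div_iff₀ hv'] at h1

/-- Modulo the fixed vector `ψ`, contractions of `N` fixing `ψ` are contractions for a gauge
comparable with the norm of the projection to the complement of `ψ`. -/
theorem exists_quotient_gauge {ψ : Vec d} (hψ : ‖ψ‖ = 1) (N : Seminorm ℂ (Vec d))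
    (hN : ∀ v, N v = 0 → v = 0) :
    ∃ (g : Vec d → ℝ) (a b : ℝ), 0 < a ∧ 0 < b ∧
      (∀ v, a * ‖projCompl ψ v‖ ≤ g v ∧ g v ≤ b * ‖projCompl ψ v‖) ∧
      ∀ T : Op d, T ψ = ψ → (∀ v, N (T v) ≤ N v) → ∀ v, g (T v) ≤ g v := by
  have : Nontrivial (Vec d) := ⟨⟨ψ, 0, fun h => by simp [h] at hψ⟩⟩
  obtain ⟨a, b, ha, hb, hab⟩ := N.equiv_norm_of_definite hN
  have hbdd : ∀ v, BddBelow (Set.range fun c : ℂ => N (v + c • ψ)) := fun v =>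
    ⟨0, by rintro _ ⟨c, rfl⟩; exact apply_nonneg N _⟩
  -- The quotient norm modulo `ψ`. The lower bound holds because shifts along `ψ` do not change the
  -- projection; the upper one takes `c = -inner ℂ ψ v`.
  refine ⟨fun v => ⨅ c : ℂ, N (v + c • ψ), a, b, ha, hb, fun v => ⟨?_, ?_⟩, ?_⟩
  · refine le_ciInf fun c => le_trans ?_ (hab _).1
    rw [← projCompl_add_smul hψ v c]
    exact mul_le_mul_of_nonneg_left (norm_projCompl_apply_le hψ _) ha.le
  · refine (ciInf_le (hbdd v) (-inner ℂ ψ v)).trans ?_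
    rw [projCompl_apply, sub_eq_add_neg, ← neg_smul]
    exact (hab _).2
  · intro T hT hTN v
    refine ciInf_mono (hbdd _) fun c => ?_
    have := hTN (v + c • ψ)
    rwa [map_add, map_smul, hT] at this

theorem exists_uniform_norm_bound {ψ : Vec d} (hψ : ‖ψ‖ = 1) (N : Seminorm ℂ (Vec d))
    (hN : ∀ v, N v = 0 → v = 0) :
    ∃ K : ℝ, 0 < K ∧ ∀ T : Op d, (∀ v, N (T v) ≤ N v) → ‖T‖ ≤ K := by
  have : Nontrivial (Vec d) := ⟨⟨ψ, 0, fun h => by simp [h] at hψ⟩⟩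
  obtain ⟨a, b, ha, hb, hab⟩ := N.equiv_norm_of_definite hN
  refine ⟨b / a, by positivity, fun T hT => T.opNorm_le_bound (by positivity) fun v => ?_⟩
  rw [div_mul_eq_mul_div, le_div_iff₀ ha, mul_comm]
  exact (hab _).1.trans ((hT v).trans (hab v).2)

theorem mem_spectrum_iff_hasEigenvalue (A : Op d) (z : ℂ) :
    z ∈ spectrum ℂ A ↔ Module.End.HasEigenvalue (A : Vec d →ₗ[ℂ] Vec d) z := by
  rw [Module.End.hasEigenvalue_iff_mem_spectrum,
    ← AlgEquiv.spectrum_eq (Module.End.toContinuousLinearMap (Vec d)) (A : Vec d →ₗ[ℂ] Vec d)]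
  rfl

/-- Gelfand's formula: eventually `‖b ^ n‖ < r ^ n` for some `r < 1` above the spectral radius. -/
theorem tendsto_pow_of_spectrum_lt_one {B : Type*} [NormedRing B] [NormedAlgebra ℂ B]
    [CompleteSpace B] [Nontrivial B] (b : B) (h : ∀ z ∈ spectrum ℂ b, ‖z‖ < 1) :
    Tendsto (fun n : ℕ => b ^ n) atTop (𝓝 0) := by
  have hr : spectralRadius ℂ b < 1 :=
    spectrum.spectralRadius_lt_of_forall_lt b (r := 1) fun z hz => by
      simpa [← NNReal.coe_lt_coe] using h z hz
  obtain ⟨r, hr1, hr2⟩ := exists_between hr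
  have hev := (spectrum.pow_nnnorm_pow_one_div_tendsto_nhds_spectralRadius b).eventually_lt_const
    hr1
  have ht : Tendsto (fun n : ℕ => r ^ n) atTop (𝓝 0) :=
    ENNReal.tendsto_pow_atTop_nhds_zero_of_lt_one hr2
  rw [tendsto_zero_iff_enorm_tendsto_zero]
  refine tendsto_of_tendsto_of_tendsto_of_le_of_le' tendsto_const_nhds ht
    (Eventually.of_forall fun _ => zero_le) ?_
  filter_upwards [hev, eventually_gt_atTop 0] with n hn hn0
  have h1 := ENNReal.rpow_le_rpow hn.le (Nat.cast_nonneg n)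
  rwa [← ENNReal.rpow_mul, one_div, inv_mul_cancel₀ (by positivity), ENNReal.rpow_one,
    ENNReal.rpow_natCast] at h1

/-- In the quotient `A` loses one copy of the eigenvalue 1. An eigenvector there with `1 ≤ ‖z‖`
lifts to a generalized eigenvector of `A`: for `z = 1` it contradicts simplicity, otherwise it puts
a second point of the spectrum on the unit circle. -/
theorem norm_lt_one_of_mem_spectrum_projCompl_mul {ψ : Vec d} (hψ : ‖ψ‖ = 1)
    (N : Seminorm ℂ (Vec d)) (hN : ∀ v, N v = 0 → v = 0) {A : Op d} (hA : A ψ = ψ)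
    (hAN : ∀ v, N (A v) ≤ N v) (hE : A ∈ ME d) {z : ℂ}
    (hz : z ∈ spectrum ℂ (projCompl ψ * A)) : ‖z‖ < 1 := by
  by_contra! hz1
  have hz0 : z ≠ 0 := fun h => by simp [h] at hz1; linarith
  have hψ0 : ψ ≠ 0 := fun h => by simp [h] at hψ
  obtain ⟨v, hv⟩ := ((mem_spectrum_iff_hasEigenvalue _ _).1 hz).exists_hasEigenvector
  have hv0 : v ≠ 0 := hv.2
  have hveq : projCompl ψ (A v) = z • v := hv.apply_eq_smul
  have hort : inner ℂ ψ v = 0 := by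
    have := inner_projCompl hψ (A v)
    rw [hveq, inner_smul_right] at this
    exact (mul_eq_zero.1 this).resolve_left hz0
  obtain ⟨c, hc⟩ : ∃ c : ℂ, A v = z • v + c • ψ :=
    ⟨inner ℂ ψ (A v), by rw [← hveq, projCompl_apply]; abel⟩
  rcases eq_or_ne z 1 with rfl | hne
  · have hfin := hE.2
    have hvm : v ∈ Module.End.maxGenEigenspace (A : Vec d →ₗ[ℂ] Vec d) 1 := by
      rw [Module.End.mem_maxGenEigenspace]
      -- `A - 1` maps `v` to `c • ψ`, and `ψ` to 0.
      refine ⟨2, ?_⟩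
      simp [pow_two, hc, hA]
    have hpm : ψ ∈ Module.End.maxGenEigenspace (A : Vec d →ₗ[ℂ] Vec d) 1 := by
      rw [Module.End.mem_maxGenEigenspace]
      exact ⟨1, by simp [hA]⟩
    obtain ⟨t, ht⟩ := (finrank_eq_one_iff_of_nonzero'
      (⟨ψ, hpm⟩ : Module.End.maxGenEigenspace (A : Vec d →ₗ[ℂ] Vec d) 1)
      (fun h => hψ0 (congrArg Subtype.val h))).1 hfin ⟨v, hvm⟩
    have ht' : t • ψ = v := congrArg Subtype.val ht
    rw [← ht', inner_smul_right, inner_self_eq_norm_sq_to_K, hψ] at hort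
    simp at hort
    exact hv0 (by rw [← ht', hort, zero_smul])
  · have hz' : z - 1 ≠ 0 := sub_ne_zero.2 hne
    -- The coefficient `t` solves `c + t = z * t`, which makes `v + t • ψ` an eigenvector of `A`.
    set w := v + (c / (z - 1)) • ψ with hw
    have hw0 : w ≠ 0 := fun h => by
      have h2 := congrArg (projCompl ψ) h
      rw [hw, projCompl_add_smul hψ, projCompl_of_inner_eq_zero hort, map_zero] at h2
      exact hv0 h2
    have hAw : A w = z • w := by
      rw [hw, map_add, map_smul, hA, hc, smul_add, add_assoc, ← add_smul, smul_smul]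
      congr 2
      field_simp
      ring
    have hNw : 0 < N w := lt_of_le_of_ne (apply_nonneg N w) fun h => hw0 (hN w h.symm)
    have hle : ‖z‖ ≤ 1 := by
      have := hAN w
      rw [hAw, map_smul_eq_mul] at this
      exact le_of_mul_le_mul_right (by rwa [one_mul]) hNw
    have hmem : z ∈ spectrum ℂ A ∩ Metric.sphere (0 : ℂ) 1 := by
      refine ⟨(mem_spectrum_iff_hasEigenvalue _ _).2 ?_, by simpa using le_antisymm hle hz1⟩
      exact Module.End.hasEigenvalue_of_hasEigenvector
        (Module.End.hasEigenvector_iff.2 ⟨Module.End.mem_eigenspace_iff.2 hAw, hw0⟩)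
    rw [hE.1] at hmem
    exact hne hmem

/-- With `Q = projCompl ψ`, the relation `Q A Q = Q A` lets the inner projections be dropped. The
outer `Q` is needed for `k = 0`. -/
theorem projCompl_mul_pow {ψ : Vec d} (hψ : ‖ψ‖ = 1) {A : Op d} (hA : A ψ = ψ) (k : ℕ) (v : Vec d) :
    projCompl ψ (((projCompl ψ * A) ^ k) v) = projCompl ψ ((A ^ k) v) := by
  induction k with
  | zero => simp
  | succ k ih =>
    rw [pow_succ', pow_succ', mul_apply_eq_comp, mul_apply_eq_comp,
      mul_apply_eq_comp, ← projCompl_apply_projCompl hψ hA ((A ^ k) v), ← ih,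
      projCompl_apply_projCompl hψ hA, projCompl_of_inner_eq_zero (inner_projCompl hψ _)]

theorem exists_norm_projCompl_pow_lt {ψ : Vec d} (hψ : ‖ψ‖ = 1)
    (N : Seminorm ℂ (Vec d)) (hN : ∀ v, N v = 0 → v = 0) {A : Op d} (hA : A ψ = ψ)
    (hAN : ∀ v, N (A v) ≤ N v) (hE : A ∈ ME d) {ε : ℝ} (hε : 0 < ε) :
    ∃ k : ℕ, 0 < k ∧ ‖projCompl ψ * A ^ k‖ < ε := by
  have : Nontrivial (Vec d) := ⟨⟨ψ, 0, fun h => by simp [h] at hψ⟩⟩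
  have h := tendsto_pow_of_spectrum_lt_one (projCompl ψ * A) fun z hz =>
    norm_lt_one_of_mem_spectrum_projCompl_mul hψ N hN hA hAN hE hz
  have h2 : Tendsto (fun k : ℕ => ‖projCompl ψ * A ^ k‖) atTop (𝓝 0) := by
    have h3 := (h.const_mul (projCompl ψ)).norm
    simp only [mul_zero, norm_zero] at h3
    refine h3.congr fun k => congrArg norm ?_
    ext1 v
    exact projCompl_mul_pow hψ hA k v
  obtain ⟨k, h4, h5⟩ := ((h2.eventually_lt_const hε).and (eventually_gt_atTop 0)).exists
  exact ⟨k, h5, h4⟩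

end

/-! ### Random products and their contraction over blocks -/

noncomputable section

variable {Ω : Type*} {d : ℕ} {M : Ω → Op d}

theorem Phi_add (M : Ω → Op d) (ω : ℕ → Ω) (m k : ℕ) :
    Phi M ω (m + k) = Phi M (fun i => ω (m + i)) k * Phi M ω m := by
  induction k with
  | zero => simp [Phi]
  | succ k ih => rw [← add_assoc, Phi, ih, Phi, mul_assoc]

theorem Psi_add (M : Ω → Op d) (ω : ℕ → Ω) (m k : ℕ) :
    Psi M ω (m + k) = Psi M ω m * Psi M (fun i => ω (m + i)) k := by
  induction k with
  | zero => simp [Psi]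
  | succ k ih => rw [← add_assoc, Psi, ih, Psi, mul_assoc]

theorem Phi_induction {P : Op d → Prop} (h1 : P 1) (hmul : ∀ S T, P S → P T → P (S * T))
    (hM : ∀ ω, P (M ω)) (ω : ℕ → Ω) (n : ℕ) : P (Phi M ω n) := by
  induction n with
  | zero => exact h1
  | succ n ih => exact hmul _ _ (hM _) ih

theorem Psi_induction {P : Op d → Prop} (h1 : P 1) (hmul : ∀ S T, P S → P T → P (S * T))
    (hM : ∀ ω, P (M ω)) (ω : ℕ → Ω) (n : ℕ) : P (Psi M ω n) := by
  induction n with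
  | zero => exact h1
  | succ n ih => exact hmul _ _ ih (hM _)

theorem Phi_fixed {ψ : Vec d} (hM : ∀ ω, M ω ψ = ψ) (ω : ℕ → Ω) (n : ℕ) :
    Phi M ω n ψ = ψ :=
  Phi_induction (P := fun T => T ψ = ψ) rfl
    (fun S T hS hT => by rw [mul_apply_eq_comp, hT, hS]) hM ω n

theorem Psi_fixed {ψ : Vec d} (hM : ∀ ω, M ω ψ = ψ) (ω : ℕ → Ω) (n : ℕ) :
    Psi M ω n ψ = ψ :=
  Psi_induction (P := fun T => T ψ = ψ) rfl
    (fun S T hS hT => by rw [mul_apply_eq_comp, hT, hS]) hM ω n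

theorem Phi_gauge_le {g : Vec d → ℝ} (hM : ∀ ω v, g (M ω v) ≤ g v) (ω : ℕ → Ω) (n : ℕ) :
    ∀ v, g (Phi M ω n v) ≤ g v :=
  Phi_induction (P := fun T => ∀ v, g (T v) ≤ g v) (fun _ => le_rfl)
    (fun _ _ hS hT v => (hS _).trans (hT v)) hM ω n

theorem Psi_gauge_le {g : Vec d → ℝ} (hM : ∀ ω v, g (M ω v) ≤ g v) (ω : ℕ → Ω) (n : ℕ) :
    ∀ v, g (Psi M ω n v) ≤ g v :=
  Psi_induction (P := fun T => ∀ v, g (T v) ≤ g v) (fun _ => le_rfl)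
    (fun _ _ hS hT v => (hS _).trans (hT v)) hM ω n

/-- Continuity of multiplication at `(A, …, A)`. One neighbourhood serves both orders of the
product. -/
theorem exists_nhds_forall_prod_mem (M : Ω → Op d) (A : Op d) (k : ℕ) :
    ∀ W ∈ 𝓝 (A ^ k), ∃ U ∈ 𝓝 A, ∀ ω : ℕ → Ω, (∀ i < k, M (ω i) ∈ U) →
      Phi M ω k ∈ W ∧ Psi M ω k ∈ W := by
  induction k with
  | zero => exact fun W hW => ⟨Set.univ, univ_mem, fun ω _ =>
      ⟨by simpa [Phi] using mem_of_mem_nhds hW, by simpa [Psi] using mem_of_mem_nhds hW⟩⟩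
  | succ k ih =>
    intro W hW
    have h1 : Tendsto (fun q : Op d × Op d => q.1 * q.2) (𝓝 A ×ˢ 𝓝 (A ^ k))
        (𝓝 (A ^ (k + 1))) := by
      rw [pow_succ', ← nhds_prod_eq]; exact continuous_mul.tendsto (A, A ^ k)
    have h2 : Tendsto (fun q : Op d × Op d => q.1 * q.2) (𝓝 (A ^ k) ×ˢ 𝓝 A)
        (𝓝 (A ^ (k + 1))) := by
      rw [pow_succ, ← nhds_prod_eq]; exact continuous_mul.tendsto (A ^ k, A)
    obtain ⟨U1, hU1, V1, hV1, h1'⟩ := mem_prod_iff.1 (h1 hW)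
    obtain ⟨V2, hV2, U2, hU2, h2'⟩ := mem_prod_iff.1 (h2 hW)
    obtain ⟨U3, hU3, h3⟩ := ih _ (inter_mem hV1 hV2)
    refine ⟨U1 ∩ U2 ∩ U3, inter_mem (inter_mem hU1 hU2) hU3, fun ω hω => ?_⟩
    have hk := h3 ω fun i hi => (hω i (by omega)).2
    exact ⟨@h1' (M (ω k), Phi M ω k) ⟨(hω k (by omega)).1.1, hk.1.1⟩,
      @h2' (Psi M ω k, M (ω k)) ⟨hk.2.2, (hω k (by omega)).1.2⟩⟩

/-- There are a gauge on the quotient by the invariant vector and a set of positive measure such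
that products of `k` factors from that set halve the gauge. -/
theorem exists_contracting_set [MeasurableSpace Ω] (p : Measure Ω) {ψ : Vec d}
    (hM : IsRRDO M ψ) (hpos : 0 < p {ω | M ω ∈ ME d}) :
    ∃ (g : Vec d → ℝ) (a b : ℝ) (k : ℕ) (G : Set Ω), 0 < a ∧ 0 < b ∧ 0 < k ∧
      MeasurableSet G ∧ 0 < p G ∧
      (∀ v, a * ‖projCompl ψ v‖ ≤ g v ∧ g v ≤ b * ‖projCompl ψ v‖) ∧
      (∀ ω v, g (M ω v) ≤ g v) ∧
      ∀ ω : ℕ → Ω, (∀ i < k, ω i ∈ G) → ∀ v,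
        g (Phi M ω k v) ≤ 1 / 2 * g v ∧ g (Psi M ω k v) ≤ 1 / 2 * g v := by
  have hψ := hM.norm_eq_one
  obtain ⟨N, hN, hMN⟩ := hM.exists_norm
  obtain ⟨g, a, b, ha, hb, hg, hgT⟩ := exists_quotient_gauge hψ N hN
  have : FiniteDimensional ℂ (Op d) := inferInstance
  have : ProperSpace (Op d) := FiniteDimensional.proper ℂ _
  -- Intersecting with the range makes the point `A` found below a value of `M`, hence a contraction
  -- fixing `ψ`. Measurability of this set is not needed: only a lower bound on its outer measure is
  -- used.
  have hne : p.map M (ME d ∩ Set.range M) ≠ 0 := by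
    refine (lt_of_lt_of_le hpos ?_).ne'
    refine le_trans (measure_mono fun ω hω => ?_)
      (Measure.le_map_apply hM.measurable.aemeasurable (ME d ∩ Set.range M))
    exact ⟨hω, ω, rfl⟩
  obtain ⟨A, ⟨hAE, ω₀, rfl⟩, hA⟩ := exists_mem_forall_mem_nhdsWithin_pos_measure hne
  -- Passing from `g` to the norm and back costs `b / a`; this `ε` leaves exactly the factor `1 /
  -- 2`.
  obtain ⟨k, hk, hkε⟩ := exists_norm_projCompl_pow_lt hψ N hN (hM.fixed ω₀) (hMN ω₀) hAE
    (ε := a / (2 * b)) (by positivity)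
  have hWo : IsOpen {T : Op d | ‖projCompl ψ * T‖ < a / (2 * b)} :=
    isOpen_lt (by fun_prop) continuous_const
  obtain ⟨U, hU, hUW⟩ := exists_nhds_forall_prod_mem M (M ω₀) k _ (hWo.mem_nhds hkε)
  obtain ⟨U', hU'U, hU'o, hAU'⟩ := mem_nhds_iff.1 hU
  have hpG : 0 < p (M ⁻¹' U') := by
    rw [← Measure.map_apply hM.measurable hU'o.measurableSet]
    exact hA _ (mem_nhdsWithin_of_mem_nhds (hU'o.mem_nhds hAU'))
  have key : ∀ T : Op d, T ψ = ψ → ‖projCompl ψ * T‖ < a / (2 * b) →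
      ∀ v, g (T v) ≤ 1 / 2 * g v := by
    intro T hT hTn v
    have h1 : ‖projCompl ψ (T v)‖ ≤ a / (2 * b) * ‖projCompl ψ v‖ := by
      rw [← projCompl_apply_projCompl hψ hT]
      exact ((projCompl ψ * T).le_opNorm _).trans
        (mul_le_mul_of_nonneg_right hTn.le (norm_nonneg _))
    calc g (T v) ≤ b * ‖projCompl ψ (T v)‖ := (hg _).2
      _ ≤ b * (a / (2 * b) * ‖projCompl ψ v‖) := by gcongr
      _ = 1 / 2 * (a * ‖projCompl ψ v‖) := by field_simp
      _ ≤ 1 / 2 * g v := by have := (hg v).1; gcongr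
  refine ⟨g, a, b, k, M ⁻¹' U', ha, hb, hk, hM.measurable hU'o.measurableSet, hpG, hg,
    fun ω => hgT _ (hM.fixed ω) (hMN ω), fun ω hω v => ?_⟩
  have h2 := hUW ω fun i hi => hU'U (hω i hi)
  exact ⟨key _ (Phi_fixed hM.fixed ω k) h2.1 v, key _ (Psi_fixed hM.fixed ω k) h2.2 v⟩

open Classical in
/-- `1/2` if all coordinates in the `j`-th block of length `k` lie in `G`, and `1` otherwise. -/
def blockFactor (G : Set Ω) (k : ℕ) (ω : ℕ → Ω) (j : ℕ) : ℝ :=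
  if ∀ i < k, ω (j * k + i) ∈ G then 1 / 2 else 1

theorem blockFactor_pos (G : Set Ω) (k : ℕ) (ω : ℕ → Ω) (j : ℕ) : 0 < blockFactor G k ω j := by
  unfold blockFactor; split_ifs <;> norm_num

section gauge

variable {g : Vec d → ℝ} {k : ℕ} {G : Set Ω}

/-- Good blocks halve the gauge, bad ones do not increase it, and neither does the incomplete block
at the end. -/
theorem gauge_Phi_le (hM : ∀ ω v, g (M ω v) ≤ g v)
    (hG : ∀ ω : ℕ → Ω, (∀ i < k, ω i ∈ G) → ∀ v, g (Phi M ω k v) ≤ 1 / 2 * g v)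
    (ω : ℕ → Ω) (n : ℕ) (v : Vec d) :
    g (Phi M ω n v) ≤ (∏ j ∈ Finset.range (n / k), blockFactor G k ω j) * g v := by
  have hm : ∀ m, g (Phi M ω (m * k) v) ≤ (∏ j ∈ Finset.range m, blockFactor G k ω j) * g v := by
    intro m
    induction m with
    | zero => simp [Phi]
    | succ m ih =>
      rw [Nat.succ_mul, Phi_add, mul_apply_eq_comp, Finset.prod_range_succ, mul_comm (∏ j ∈ _, _),
        mul_assoc]
      refine le_trans ?_ (mul_le_mul_of_nonneg_left ih (blockFactor_pos G k ω m).le)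
      unfold blockFactor
      split_ifs with h
      · exact hG _ h _
      · rw [one_mul]; exact Phi_gauge_le hM _ _ _
  conv_lhs => rw [← Nat.div_add_mod' n k, Phi_add, mul_apply_eq_comp]
  exact (Phi_gauge_le hM _ _ _).trans (hm _)

theorem gauge_Psi_le (hM : ∀ ω v, g (M ω v) ≤ g v)
    (hG : ∀ ω : ℕ → Ω, (∀ i < k, ω i ∈ G) → ∀ v, g (Psi M ω k v) ≤ 1 / 2 * g v)
    (ω : ℕ → Ω) (n : ℕ) (v : Vec d) :
    g (Psi M ω n v) ≤ (∏ j ∈ Finset.range (n / k), blockFactor G k ω j) * g v := by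
  -- In `Psi` the new block acts first, so the induction hypothesis is applied to its image and must
  -- hold for all `v`.
  have hm : ∀ m v,
      g (Psi M ω (m * k) v) ≤ (∏ j ∈ Finset.range m, blockFactor G k ω j) * g v := by
    intro m
    induction m with
    | zero => simp [Psi]
    | succ m ih =>
      intro v
      rw [Nat.succ_mul, Psi_add, mul_apply_eq_comp, Finset.prod_range_succ, mul_assoc]
      refine (ih _).trans (mul_le_mul_of_nonneg_left ?_
        (Finset.prod_nonneg fun j _ => (blockFactor_pos G k ω j).le))
      unfold blockFactor
      split_ifs with h
      · exact hG _ h _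
      · rw [one_mul]; exact Psi_gauge_le hM _ _ _
  conv_lhs => rw [← Nat.div_add_mod' n k, Psi_add, mul_apply_eq_comp]
  exact (hm _ _).trans (mul_le_mul_of_nonneg_left (Psi_gauge_le hM _ _ _)
    (Finset.prod_nonneg fun j _ => (blockFactor_pos G k ω j).le))

end gauge

end

/-! ### Independence of blocks and almost sure exponential decay -/

noncomputable section

variable {Ω : Type*}

theorem blockFactor_congr (G : Set Ω) {k j : ℕ} {ω ω' : ℕ → Ω}
    (h : ∀ i < k, ω (j * k + i) = ω' (j * k + i)) :
    blockFactor G k ω j = blockFactor G k ω' j := by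
  have : (∀ i < k, ω (j * k + i) ∈ G) ↔ ∀ i < k, ω' (j * k + i) ∈ G :=
    forall₂_congr fun i hi => by rw [h i hi]
  unfold blockFactor
  split_ifs <;> tauto

theorem setOf_block_eq_pi (G : Set Ω) (k j : ℕ) :
    {ω : ℕ → Ω | ∀ i < k, ω (j * k + i) ∈ G} =
      (↑(Finset.Ico (j * k) (j * k + k)) : Set ℕ).pi fun _ => G := by
  ext ω
  simp only [Set.mem_ofPred_eq, Set.mem_pi, Finset.coe_Ico, Set.mem_Ico]
  constructor
  · intro h i hi
    obtain ⟨r, rfl⟩ := Nat.exists_eq_add_of_le hi.1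
    exact h r (by omega)
  · exact fun h i hi => h _ ⟨by omega, by omega⟩

variable [MeasurableSpace Ω] {G : Set Ω}

theorem measurableSet_block (hG : MeasurableSet G) (k j : ℕ) :
    MeasurableSet {ω : ℕ → Ω | ∀ i < k, ω (j * k + i) ∈ G} := by
  rw [setOf_block_eq_pi]
  exact MeasurableSet.pi (Set.to_countable _) fun _ _ => hG

theorem measurable_blockFactor (hG : MeasurableSet G) (k j : ℕ) :
    Measurable fun ω : ℕ → Ω => ENNReal.ofReal (blockFactor G k ω j) :=
  ENNReal.measurable_ofReal.comp
    (Measurable.ite (measurableSet_block hG k j) measurable_const measurable_const)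

variable (p : Measure Ω) [IsProbabilityMeasure p]

instance : IsProbabilityMeasure (iidMeasure p) := by
  unfold iidMeasure; infer_instance

theorem lintegral_blockFactor (hG : MeasurableSet G) (k j : ℕ) :
    ∫⁻ ω, ENNReal.ofReal (blockFactor G k ω j) ∂iidMeasure p =
      ENNReal.ofReal (1 / 2) * p G ^ k + (1 - p G ^ k) := by
  have hP : iidMeasure p {ω : ℕ → Ω | ∀ i < k, ω (j * k + i) ∈ G} = p G ^ k := by
    rw [setOf_block_eq_pi, iidMeasure, Measure.infinitePi_pi _ fun _ _ => hG]
    simp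
  have hms := measurableSet_block hG k j
  rw [← lintegral_add_compl _ hms]
  congr 1
  · rw [← hP, ← setLIntegral_const]
    exact setLIntegral_congr_fun hms fun ω hω => by
      rw [blockFactor, if_pos (by exact hω)]
  · rw [← hP, ← prob_compl_eq_one_sub hms, ← setLIntegral_one]
    exact setLIntegral_congr_fun hms.compl fun ω hω => by
      rw [blockFactor, if_neg (by exact hω), ENNReal.ofReal_one]

theorem lintegral_blockFactor_lt_one (hG : MeasurableSet G) (hpG : 0 < p G) (k j : ℕ) :
    ∫⁻ ω, ENNReal.ofReal (blockFactor G k ω j) ∂iidMeasure p < 1 := by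
  rw [lintegral_blockFactor p hG]
  have hq1 : p G ^ k ≤ 1 := pow_le_one' prob_le_one k
  have hq0 : p G ^ k ≠ 0 := pow_ne_zero k hpG.ne'
  have hqt : p G ^ k ≠ ⊤ := (hq1.trans_lt ENNReal.one_lt_top).ne
  conv_rhs => rw [← add_tsub_cancel_of_le hq1]
  refine ENNReal.add_lt_add_right (by simp) ?_
  conv_rhs => rw [← one_mul (p G ^ k)]
  refine ENNReal.mul_lt_mul_left hq0 hqt ?_
  rw [ENNReal.ofReal_lt_one]; norm_num

open ProbabilityTheory in
theorem lintegral_prod_blockFactor (hG : MeasurableSet G) (k m : ℕ) :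
    ∫⁻ ω, ∏ j ∈ Finset.range m, ENNReal.ofReal (blockFactor G k ω j) ∂iidMeasure p =
      (∫⁻ ω, ENNReal.ofReal (blockFactor G k ω 0) ∂iidMeasure p) ^ m := by
  classical
  induction m with
  | zero => simp
  | succ m ih =>
    obtain ⟨x⟩ : Nonempty Ω := nonempty_of_isProbabilityMeasure p
    -- Filling the coordinates outside `S` with a fixed point turns a function of the whole sequence
    -- into one of the coordinates in `S`, as `indepFun_finset` requires.
    let ext (S : Finset ℕ) (y : S → Ω) (i : ℕ) : Ω := if h : i ∈ S then y ⟨i, h⟩ else x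
    have hext : ∀ S, Measurable (ext S) := by
      intro S
      refine measurable_pi_lambda _ fun i => ?_
      by_cases h : i ∈ S
      · simpa [ext, h] using measurable_pi_apply _
      · simp [ext, h]
    have hind := (iIndepFun_infinitePi (P := fun _ : ℕ => p) (X := fun _ ω => ω)
      fun _ => measurable_id).indepFun_finset (Finset.range (m * k))
      (Finset.Ico (m * k) (m * k + k))
      (Finset.disjoint_left.2 fun i hi hi' => by
        simp only [Finset.mem_range, Finset.mem_Ico] at hi hi'; omega)
      fun i => measurable_pi_apply i
    have h1 : Measurable fun ω : ℕ → Ω =>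
        ∏ j ∈ Finset.range m, ENNReal.ofReal (blockFactor G k ω j) :=
      Finset.measurable_prod _ fun j _ => measurable_blockFactor hG k j
    have h2 := measurable_blockFactor hG k m
    have hind' : IndepFun
        (fun ω : ℕ → Ω => ∏ j ∈ Finset.range m, ENNReal.ofReal (blockFactor G k ω j))
        (fun ω : ℕ → Ω => ENNReal.ofReal (blockFactor G k ω m)) (iidMeasure p) := by
      convert! hind.comp (h1.comp (hext _)) (h2.comp (hext _)) using 1
      · funext ω
        refine Finset.prod_congr rfl fun j hj => congrArg _ (blockFactor_congr G fun i hi => ?_)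
        have : j * k + i < m * k := by
          have := Nat.mul_le_mul_right k (Finset.mem_range.1 hj)
          rw [Nat.succ_mul] at this
          omega
        simp [ext, this]
      · funext ω
        refine congrArg _ (blockFactor_congr G fun i hi => ?_)
        simp [ext, hi]
    simp only [Finset.prod_range_succ]
    have h3 := lintegral_mul_eq_lintegral_mul_lintegral_of_indepFun h1 h2 hind'
    simp only [Pi.mul_apply] at h3
    rw [h3, ih, pow_succ, lintegral_blockFactor p hG, lintegral_blockFactor p hG]

/-- The product of `m` factors has mean `c ^ m` with `c < 1`. For `c < ρ < 1` the products divided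
by `ρ ^ m` have a summable series of means, so their sum is almost surely finite; this sum serves as
`C`. -/
theorem exists_ae_prod_blockFactor_le (hG : MeasurableSet G) (hpG : 0 < p G) (k : ℕ) :
    ∃ ρ : ℝ, 0 < ρ ∧ ρ < 1 ∧ ∀ᵐ ω ∂iidMeasure p, ∃ C : ℝ, 0 ≤ C ∧ ∀ m : ℕ,
      ∏ j ∈ Finset.range m, blockFactor G k ω j ≤ C * ρ ^ m := by
  obtain ⟨ρ, hcρ, hρ1⟩ := ENNReal.lt_iff_exists_nnreal_btwn.1
    (lintegral_blockFactor_lt_one p hG hpG k 0)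
  set c := ∫⁻ ω, ENNReal.ofReal (blockFactor G k ω 0) ∂iidMeasure p
  have hρ0 : (ρ : ENNReal) ≠ 0 := (zero_le.trans_lt hcρ).ne'
  have hm : ∀ m : ℕ, Measurable fun ω : ℕ → Ω =>
      (∏ j ∈ Finset.range m, ENNReal.ofReal (blockFactor G k ω j)) / (ρ : ENNReal) ^ m :=
    fun m => (Finset.measurable_prod _ fun j _ => measurable_blockFactor hG k j).div_const _
  have hint : ∫⁻ ω, ∑' m : ℕ, (∏ j ∈ Finset.range m, ENNReal.ofReal (blockFactor G k ω j)) /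
      (ρ : ENNReal) ^ m ∂iidMeasure p ≠ ⊤ := by
    rw [lintegral_tsum fun m => (hm m).aemeasurable]
    have : ∀ m : ℕ, ∫⁻ ω, (∏ j ∈ Finset.range m, ENNReal.ofReal (blockFactor G k ω j)) /
        (ρ : ENNReal) ^ m ∂iidMeasure p = (c / ρ) ^ m := by
      intro m
      simp only [div_eq_mul_inv]
      rw [lintegral_mul_const _
        (Finset.measurable_prod _ fun j _ => measurable_blockFactor hG k j),
        lintegral_prod_blockFactor p hG, mul_pow, ENNReal.inv_pow]
    simp only [this]
    rw [ENNReal.tsum_geometric]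
    refine ENNReal.inv_ne_top.2 (tsub_pos_of_lt ?_).ne'
    exact ENNReal.div_lt_of_lt_mul (by rwa [one_mul])
  refine ⟨ρ, by exact_mod_cast pos_iff_ne_zero.2 hρ0, by exact_mod_cast hρ1, ?_⟩
  filter_upwards [ae_lt_top (Measurable.tsum hm) hint] with ω hω
  refine ⟨(∑' m : ℕ, (∏ j ∈ Finset.range m, ENNReal.ofReal (blockFactor G k ω j)) /
    (ρ : ENNReal) ^ m).toReal, ENNReal.toReal_nonneg, fun m => ?_⟩
  have h1 := ENNReal.le_tsum (f := fun m : ℕ =>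
    (∏ j ∈ Finset.range m, ENNReal.ofReal (blockFactor G k ω j)) / (ρ : ENNReal) ^ m) m
  rw [ENNReal.div_le_iff (pow_ne_zero _ hρ0) (by simp),
    ← ENNReal.ofReal_prod_of_nonneg fun j _ => (blockFactor_pos G k ω j).le] at h1
  have h2 := (ENNReal.ofReal_le_iff_le_toReal (ENNReal.mul_ne_top hω.ne (by simp))).1 h1
  rwa [ENNReal.toReal_mul, ENNReal.toReal_pow, ENNReal.coe_toReal] at h2

theorem exists_ae_prod_blockFactor_le_exp (hG : MeasurableSet G) (hpG : 0 < p G) {k : ℕ}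
    (hk : 0 < k) :
    ∃ α : ℝ, 0 < α ∧ ∀ᵐ ω ∂iidMeasure p, ∃ C : ℝ, 0 ≤ C ∧ ∀ n : ℕ,
      ∏ j ∈ Finset.range (n / k), blockFactor G k ω j ≤ C * Real.exp (-α * n) := by
  obtain ⟨ρ, hρ0, hρ1, h⟩ := exists_ae_prod_blockFactor_le p hG hpG k
  have hk' : (0 : ℝ) < k := Nat.cast_pos.2 hk
  have hlog : Real.log ρ < 0 := Real.log_neg hρ0 hρ1
  refine ⟨-Real.log ρ / k, div_pos (neg_pos.2 hlog) hk', ?_⟩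
  filter_upwards [h] with ω ⟨C, hC, hω⟩
  -- The extra factor `ρ⁻¹` pays for rounding `n / k` down.
  refine ⟨C * Real.exp (-Real.log ρ), by positivity, fun n => (hω _).trans ?_⟩
  rw [mul_assoc]
  refine mul_le_mul_of_nonneg_left ?_ hC
  rw [← Real.exp_add, ← Real.exp_log (pow_pos hρ0 _), Real.log_pow]
  refine Real.exp_le_exp.2 ?_
  have h1 : (n : ℝ) / k - 1 ≤ (n / k : ℕ) := by
    have h2 : (n : ℝ) ≤ (n / k : ℕ) * k + k := by
      have := Nat.div_add_mod' n k
      have := Nat.mod_lt n hk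
      exact_mod_cast (by omega : n ≤ n / k * k + k)
    rw [sub_le_iff_le_add, div_le_iff₀ hk']
    linarith
  have h3 := mul_le_mul_of_nonpos_right h1 hlog.le
  refine h3.trans (le_of_eq ?_)
  field_simp
  ring

end

/-! ### Singular values, Lyapunov exponents and roots of `A* A` -/

noncomputable section

variable {d : ℕ}

theorem finrank_vec (d : ℕ) : Module.finrank ℂ (Vec d) = d := by simp

theorem norm_apply_sq_eq_re_inner (A : Op d) (v : Vec d) :
    ‖A v‖ ^ 2 = RCLike.re (inner ℂ ((star A * A) v) v) :=
  ContinuousLinearMap.apply_norm_sq_eq_inner_adjoint_left A v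

theorem sq_norm_apply_add_smul {A : Op d} {e f : Vec d} {s t : ℝ}
    (he : ‖e‖ = 1) (hf : ‖f‖ = 1) (hef : inner ℂ e f = 0)
    (hAe : (star A * A) e = (s : ℂ) • e) (hAf : (star A * A) f = (t : ℂ) • f) (a b : ℂ) :
    ‖A (a • e + b • f)‖ ^ 2 = s * ‖a‖ ^ 2 + t * ‖b‖ ^ 2 := by
  have hfe : inner ℂ f e = 0 := inner_eq_zero_symm.1 hef
  rw [norm_apply_sq_eq_re_inner, map_add, map_smul, map_smul, hAe, hAf]
  simp only [inner_add_left, inner_add_right, inner_smul_left, inner_smul_right, hef, hfe,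
    inner_self_eq_norm_sq_to_K, he, hf, ← Complex.normSq_eq_norm_sq]
  simp [Complex.normSq_apply]
  ring

/-- The two-dimensional case of the min-max bound for the second singular value. -/
theorem le_sq_norm_projCompl_mul {ψ : Vec d} {A : Op d} {e f : Vec d} {s t : ℝ}
    (he : ‖e‖ = 1) (hf : ‖f‖ = 1) (hef : inner ℂ e f = 0)
    (hAe : (star A * A) e = (s : ℂ) • e) (hAf : (star A * A) f = (t : ℂ) • f) (hts : t ≤ s) :
    t ≤ ‖projCompl ψ * A‖ ^ 2 := by
  -- If the image of `a • e + b • f` is orthogonal to `ψ`, the projection leaves it unchanged. The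
  -- plane of `e` and `f` contains a nonzero such vector.
  have key : ∀ a b : ℂ, a * inner ℂ ψ (A e) + b * inner ℂ ψ (A f) = 0 →
      t * (‖a‖ ^ 2 + ‖b‖ ^ 2) ≤ ‖projCompl ψ * A‖ ^ 2 * (‖a‖ ^ 2 + ‖b‖ ^ 2) := by
    intro a b hab
    have h1 : projCompl ψ (A (a • e + b • f)) = A (a • e + b • f) :=
      projCompl_of_inner_eq_zero (by
        rw [map_add, map_smul, map_smul, inner_add_right, inner_smul_right, inner_smul_right, hab])
    have h2 := (projCompl ψ * A).le_opNorm (a • e + b • f)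
    rw [mul_apply_eq_comp, h1] at h2
    have h3 := pow_le_pow_left₀ (norm_nonneg _) h2 2
    have h4 : ‖a • e + b • f‖ ^ 2 = ‖a‖ ^ 2 + ‖b‖ ^ 2 := by
      have := norm_add_sq_eq_norm_sq_add_norm_sq_of_inner_eq_zero (a • e) (b • f)
        (by rw [inner_smul_left, inner_smul_right, hef]; simp)
      simp only [norm_smul, he, hf, mul_one] at this
      rw [pow_two, this]; ring
    rw [mul_pow, sq_norm_apply_add_smul he hf hef hAe hAf, h4] at h3
    nlinarith [mul_nonneg (sub_nonneg.2 hts) (sq_nonneg ‖a‖)]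
  by_cases h0 : inner ℂ ψ (A e) = 0
  · simpa using key 1 0 (by simp [h0])
  · refine le_of_mul_le_mul_right
      (key (inner ℂ ψ (A f)) (-inner ℂ ψ (A e)) (by ring)) ?_
    have := norm_pos_iff.2 h0
    rw [norm_neg]
    positivity

/-- The second alternative in `hv` allows one large eigenvalue, provided `v` is orthogonal to its
eigenvector. -/
theorem norm_apply_le_of_forall_eigenvector {ι : Type*} [Fintype ι]
    (e : OrthonormalBasis ι ℂ (Vec d)) (S : Op d) (r : ι → ℝ) (he : ∀ i, S (e i) = (r i : ℂ) • e i)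
    {t : ℝ} (ht : 0 ≤ t) {v : Vec d} (hv : ∀ i, |r i| ≤ t ∨ inner ℂ (e i) v = 0) :
    ‖S v‖ ≤ t * ‖v‖ := by
  classical
  have hS : ∀ i, inner ℂ (e i) (S v) = r i * inner ℂ (e i) v := by
    intro i
    conv_lhs => rw [← e.sum_repr' v]
    rw [map_sum, inner_sum, Finset.sum_eq_single i]
    · rw [map_smul, he, inner_smul_right, inner_smul_right, e.inner_eq_one]; ring
    · intro j _ hj
      rw [map_smul, he, inner_smul_right, inner_smul_right, e.inner_eq_zero hj.symm]; simp
    · simp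
  refine le_of_sq_le_sq ?_ (by positivity)
  rw [mul_pow, ← e.sum_sq_norm_inner_right, ← e.sum_sq_norm_inner_right v, Finset.mul_sum]
  refine Finset.sum_le_sum fun i _ => ?_
  rw [hS, norm_mul, mul_pow]
  rcases hv i with h | h
  · rw [Complex.norm_real, Real.norm_eq_abs]
    gcongr
  · simp [h]

section singVal

variable (A : Op d)

theorem singVal_nonneg (i : ℕ) : 0 ≤ singVal A i := LinearMap.singularValues_nonneg _ _

/-- A right singular basis of an operator. -/
theorem exists_basis_star_mul_self :
    ∃ e : OrthonormalBasis (Fin d) ℂ (Vec d), ∀ i : Fin d,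
      (star A * A) (e i) = ((singVal A i ^ 2 : ℝ) : ℂ) • e i := by
  refine ⟨(A : Vec d →ₗ[ℂ] Vec d).isSymmetric_adjoint_comp_self.eigenvectorBasis (finrank_vec d),
    fun i => ?_⟩
  rw [singVal, LinearMap.sq_singularValues_fin _ (finrank_vec d)]
  exact LinearMap.IsSymmetric.apply_eigenvectorBasis _ _ _

theorem singVal_le_norm (i : Fin d) : singVal A i ≤ ‖A‖ := by
  obtain ⟨e, he⟩ := exists_basis_star_mul_self A
  have h1 := norm_apply_sq_eq_re_inner A (e i)
  rw [he, inner_smul_left, inner_self_eq_norm_sq_to_K, e.norm_eq_one] at h1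
  have h2 : ‖A (e i)‖ ^ 2 = singVal A i ^ 2 := by
    rw [h1]
    simp [-Complex.ofReal_pow]
  rw [← (sq_eq_sq₀ (norm_nonneg _) (singVal_nonneg A i)).1 h2]
  simpa using A.le_opNorm (e i)

theorem singVal_antitone : Antitone (singVal A) := LinearMap.singularValues_antitone _

theorem singVal_one_le (ψ : Vec d) (hd : 1 < d) : singVal A 1 ≤ ‖projCompl ψ * A‖ := by
  obtain ⟨e, he⟩ := exists_basis_star_mul_self A
  refine le_of_sq_le_sq ?_ (norm_nonneg _)
  exact le_sq_norm_projCompl_mul (e.norm_eq_one ⟨0, by omega⟩) (e.norm_eq_one ⟨1, hd⟩)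
    (e.inner_eq_zero (by simp)) (he ⟨0, by omega⟩) (he ⟨1, hd⟩)
    (pow_le_pow_left₀ (singVal_nonneg A 1) (singVal_antitone A zero_le_one) 2)

/-- The largest eigenvalue of `A* A` bounds its quadratic form, which is 1 at `ψ`. -/
theorem one_le_singVal_zero {ψ : Vec d} (hψ : ‖ψ‖ = 1) (hA : A ψ = ψ) : 1 ≤ singVal A 0 := by
  obtain ⟨e, he⟩ := exists_basis_star_mul_self A
  have h1 := norm_apply_le_of_forall_eigenvector e (star A * A) _ he (sq_nonneg (singVal A 0))
    (v := ψ) fun i => Or.inl (by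
      rw [abs_of_nonneg (sq_nonneg _)]
      exact pow_le_pow_left₀ (singVal_nonneg A i) (singVal_antitone A (Nat.zero_le _)) 2)
  have h2 := norm_apply_sq_eq_re_inner A ψ
  have h3 := re_inner_le_norm (𝕜 := ℂ) ((star A * A) ψ) ψ
  rw [← h2, hA, hψ] at h3
  rw [hψ] at h1
  nlinarith [singVal_nonneg A 0]

end singVal

section exponents

variable {A : ℕ → Op d} {ψ : Vec d} {K C α : ℝ}

theorem tendsto_log_singVal_zero (hψ : ‖ψ‖ = 1) (hA : ∀ n, A n ψ = ψ) (hK : ∀ n, ‖A n‖ ≤ K) :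
    Tendsto (fun n : ℕ => Real.log (singVal (A n) 0) / n) atTop (𝓝 0) := by
  have hd : 0 < d := Nat.pos_of_ne_zero fun h => by
    subst h
    rw [Subsingleton.elim ψ 0] at hψ
    simp at hψ
  refine squeeze_zero (g := fun n : ℕ => Real.log K / n) (fun n => ?_) (fun n => ?_)
    (tendsto_const_div_atTop_nhds_zero_nat _)
  · exact div_nonneg (Real.log_nonneg (one_le_singVal_zero _ hψ (hA n))) (Nat.cast_nonneg n)
  · have h1 := one_le_singVal_zero _ hψ (hA n)
    have h2 := (singVal_le_norm (A n) ⟨0, hd⟩).trans (hK n)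
    have := Real.log_le_log (by linarith) h2
    gcongr

theorem ENNReal_log_ofReal_div {x : ℝ} (hx : 0 < x) (n : ℕ) :
    ENNReal.log (ENNReal.ofReal x) / (n : EReal) = ((Real.log x / n : ℝ) : EReal) := by
  rw [ENNReal.log_ofReal_of_pos hx, EReal.coe_div]
  rfl

theorem lyapunovExponent_zero_eq (hψ : ‖ψ‖ = 1) (hA : ∀ n, A n ψ = ψ) (hK : ∀ n, ‖A n‖ ≤ K) :
    lyapunovExponent A 0 = 0 := by
  have h := (continuous_coe_real_ereal.tendsto 0).comp (tendsto_log_singVal_zero hψ hA hK)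
  have h2 : (fun n : ℕ => ENNReal.log (ENNReal.ofReal (singVal (A n) 0)) / (n : EReal)) =
      Real.toEReal ∘ fun n : ℕ => Real.log (singVal (A n) 0) / n := by
    funext n
    exact ENNReal_log_ofReal_div (by linarith [one_le_singVal_zero _ hψ (hA n)]) n
  rw [lyapunovExponent, h2, h.limsup_eq, EReal.coe_zero]

/-- Lower singular values may vanish, so the comparison is made in `EReal`, where the logarithm is
monotone down to `⊥`. -/
theorem lyapunovExponent_le_neg (hC : 0 < C)
    (hQ : ∀ n : ℕ, ‖projCompl ψ * A n‖ ≤ C * Real.exp (-α * n)) {i : ℕ} (hi : 1 ≤ i) (hid : i < d) :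
    lyapunovExponent A i ≤ ((-α : ℝ) : EReal) := by
  have h1 : Tendsto (fun n : ℕ => Real.log (C * Real.exp (-α * n)) / n) atTop (𝓝 (-α)) := by
    have h2 := (tendsto_const_div_atTop_nhds_zero_nat (Real.log C)).add_const (-α)
    rw [zero_add] at h2
    refine h2.congr' ?_
    filter_upwards [eventually_gt_atTop 0] with n hn
    have hn' : (n : ℝ) ≠ 0 := by positivity
    rw [Real.log_mul hC.ne' (Real.exp_ne_zero _), Real.log_exp]
    field_simp
  rw [← ((continuous_coe_real_ereal.tendsto _).comp h1).limsup_eq, lyapunovExponent]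
  refine limsup_le_limsup (Eventually.of_forall fun n => ?_)
  simp only [Function.comp_apply]
  rw [← ENNReal_log_ofReal_div (by positivity)]
  refine EReal.div_le_div_right_of_nonneg (by positivity) (ENNReal.log_monotone ?_)
  exact ENNReal.ofReal_le_ofReal (((singVal_antitone (A n) hi).trans
    (singVal_one_le (A n) ψ (hi.trans_lt hid))).trans (hQ n))

theorem topLyapunovMultiplicity_eq_one (hψ : ‖ψ‖ = 1) (hA : ∀ n, A n ψ = ψ)
    (hK : ∀ n, ‖A n‖ ≤ K) (hC : 0 < C) (hα : 0 < α)
    (hQ : ∀ n : ℕ, ‖projCompl ψ * A n‖ ≤ C * Real.exp (-α * n)) :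
    topLyapunovMultiplicity A = 1 := by
  have hd : 0 < d := Nat.pos_of_ne_zero fun h => by
    subst h
    rw [Subsingleton.elim ψ 0] at hψ
    simp at hψ
  rw [topLyapunovMultiplicity, Set.ncard_eq_one]
  refine ⟨0, Set.eq_singleton_iff_unique_mem.2 ⟨⟨hd, rfl⟩, fun i hi => ?_⟩⟩
  by_contra hi0
  have h1 := lyapunovExponent_le_neg hC hQ (Nat.one_le_iff_ne_zero.2 hi0) hi.1
  rw [hi.2, lyapunovExponent_zero_eq hψ hA hK, ← EReal.coe_zero, EReal.coe_le_coe_iff] at h1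
  linarith

theorem absRoot_nonneg (A : ℕ → Op d) (n : ℕ) : 0 ≤ absRoot A n := CFC.rpow_nonneg

theorem absRoot_pow (A : ℕ → Op d) {n : ℕ} (hn : n ≠ 0) :
    absRoot A n ^ (2 * n) = star (A n) * A n := by
  have h0 : 0 ≤ star (A n) * A n := star_mul_self_nonneg _
  rw [← CFC.rpow_natCast _ _ (absRoot_nonneg A n), absRoot,
    CFC.rpow_rpow_of_exponent_nonneg _ _ _ (by positivity) (by positivity) h0]
  have : 1 / (2 * (n : ℝ)) * ((2 * n : ℕ) : ℝ) = 1 := by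
    push_cast
    field_simp
  rw [this, CFC.rpow_one _ h0]

theorem norm_absRoot (A : ℕ → Op d) {n : ℕ} (hn : n ≠ 0) :
    ‖absRoot A n‖ = ‖A n‖ ^ (1 / (n : ℝ)) := by
  have h0 : 0 ≤ star (A n) * A n := star_mul_self_nonneg _
  have h1 : ‖star (A n) * A n‖ = ‖A n‖ * ‖A n‖ :=
    ContinuousLinearMap.norm_adjoint_comp_self (A n)
  rw [absRoot, CFC.norm_rpow _ (by positivity) h0, h1, ← pow_two,
    ← Real.rpow_natCast, ← Real.rpow_mul (norm_nonneg _)]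
  congr 1
  push_cast
  field_simp

theorem tendsto_norm_absRoot (hψ : ‖ψ‖ = 1) (hA : ∀ n, A n ψ = ψ) (hK : ∀ n, ‖A n‖ ≤ K) :
    Tendsto (fun n => ‖absRoot A n‖) atTop (𝓝 1) := by
  have h1 : ∀ n, 1 ≤ ‖A n‖ := fun n => by
    have := (A n).le_opNorm ψ
    rwa [hA, hψ, mul_one] at this
  have hK1 : 1 ≤ K := (h1 0).trans (hK 0)
  have h2 : Tendsto (fun n : ℕ => K ^ (1 / (n : ℝ))) atTop (𝓝 1) := by
    have := (Real.continuousAt_const_rpow (by positivity : K ≠ 0)).tendsto.comp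
      (tendsto_const_div_atTop_nhds_zero_nat (1 : ℝ))
    rwa [Real.rpow_zero] at this
  refine tendsto_of_tendsto_of_tendsto_of_le_of_le' tendsto_const_nhds h2 ?_ ?_
  · filter_upwards [eventually_ne_atTop 0] with n hn
    rw [norm_absRoot A hn]
    exact Real.one_le_rpow (h1 n) (by positivity)
  · filter_upwards [eventually_ne_atTop 0] with n hn
    rw [norm_absRoot A hn]
    exact Real.rpow_le_rpow (norm_nonneg _) (hK n) (by positivity)

/-- On a hyperplane, `(A n* A n)^{1/2n}` is bounded by the `n`-th root of `‖projCompl ψ * A n‖`. -/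
theorem exists_norm_absRoot_apply_le (A : ℕ → Op d) (ψ : Vec d) {n : ℕ} (hn : n ≠ 0) {δ : ℝ}
    (hδ : 0 ≤ δ) (hQ : ‖projCompl ψ * A n‖ ≤ δ ^ n) :
    ∃ u : Vec d, ∀ v, inner ℂ u v = 0 → ‖absRoot A n v‖ ≤ δ * ‖v‖ := by
  have hpos := (ContinuousLinearMap.isPositive_toLinearMap_iff _).2
    ((ContinuousLinearMap.nonneg_iff_isPositive _).1 (absRoot_nonneg A n))
  have hsym := hpos.isSymmetric
  -- Diagonalizing the root itself also diagonalizes `A n* A n`, with eigenvalues `r i ^ (2 * n)`.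
  -- The vector `u` will be the top eigenvector.
  set e := hsym.eigenvectorBasis (finrank_vec d) with he
  set r := hsym.eigenvalues (finrank_vec d) with hr
  have hr0 : ∀ i, 0 ≤ r i := fun i => hpos.nonneg_eigenvalues (finrank_vec d) i
  have hre : ∀ i, absRoot A n (e i) = (r i : ℂ) • e i := fun i =>
    hsym.apply_eigenvectorBasis (finrank_vec d) i
  have hpow : ∀ i, (star (A n) * A n) (e i) = ((r i ^ (2 * n) : ℝ) : ℂ) • e i := by
    intro i
    rw [← absRoot_pow A hn]
    induction 2 * n with
    | zero => simp
    | succ m ih =>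
      rw [pow_succ', mul_apply_eq_comp, ih, map_smul, hre, smul_smul]
      push_cast
      rw [pow_succ]
  rcases Nat.eq_zero_or_pos d with hd | hd
  · subst hd
    exact ⟨0, fun v _ => by rw [Subsingleton.elim v 0]; simp⟩
  refine ⟨e ⟨0, hd⟩, fun v hv => norm_apply_le_of_forall_eigenvector e _ r hre hδ fun i => ?_⟩
  by_cases hi : i = ⟨0, hd⟩
  · exact Or.inr (hi ▸ hv)
  refine Or.inl ?_
  rw [abs_of_nonneg (hr0 i)]
  have h0i : r i ≤ r ⟨0, hd⟩ := hsym.eigenvalues_antitone (finrank_vec d) (Nat.zero_le _)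
  have h1 := le_sq_norm_projCompl_mul (ψ := ψ) (e.norm_eq_one ⟨0, hd⟩) (e.norm_eq_one i)
    (e.inner_eq_zero (Ne.symm hi)) (hpow _) (hpow i) (pow_le_pow_left₀ (hr0 i) h0i _)
  have h2 : r i ^ (2 * n) ≤ δ ^ (2 * n) := by
    refine h1.trans ?_
    rw [mul_comm 2 n, pow_mul]
    exact pow_le_pow_left₀ (norm_nonneg _) hQ 2
  exact (pow_le_pow_iff_left₀ (hr0 i) hδ (by omega)).1 h2

theorem exists_ne_zero_mem_inner_eq_zero (E : Submodule ℂ (Vec d)) (hE : 1 < Module.finrank ℂ E)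
    (u : Vec d) : ∃ v ∈ E, v ≠ 0 ∧ inner ℂ u v = 0 := by
  by_contra! h
  have hinj : Function.Injective ((innerSL ℂ u : Vec d →ₗ[ℂ] ℂ).comp E.subtype) := by
    rw [injective_iff_map_eq_zero]
    intro v hv
    by_contra hv0
    exact h v v.2 (fun h0 => hv0 (Subtype.ext h0)) hv
  have := LinearMap.finrank_le_finrank_of_injective hinj
  rw [Module.finrank_self] at this
  omega

/-- `Λ` is positive of norm 1, so 1 is its largest eigenvalue; being self-adjoint, it has equal
geometric and algebraic multiplicities. An eigenspace of dimension at least 2 would meet the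
hyperplane on which the `n`-th root is bounded by `δ < 1`, impossible once the root is close to `Λ`.
-/
theorem eigen_limit_absRoot (hψ : ‖ψ‖ = 1) (hA : ∀ n, A n ψ = ψ)
    (hK : ∀ n, ‖A n‖ ≤ K) (hα : 0 < α)
    (hQ : ∀ n : ℕ, ‖projCompl ψ * A n‖ ≤ C * Real.exp (-α * n)) {Λ : Op d}
    (hΛ : Tendsto (absRoot A) atTop (𝓝 Λ)) :
    IsGreatest {r : ℝ | Module.End.HasEigenvalue (Λ : Vec d →ₗ[ℂ] Vec d) (r : ℂ)} 1 ∧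
      Module.finrank ℂ (Module.End.eigenspace (Λ : Vec d →ₗ[ℂ] Vec d) 1) = 1 := by
  have : Nontrivial (Vec d) := ⟨⟨ψ, 0, fun h => by simp [h] at hψ⟩⟩
  have hΛ1 : ‖Λ‖ = 1 := tendsto_nhds_unique hΛ.norm (tendsto_norm_absRoot hψ hA hK)
  have hΛ0 : 0 ≤ Λ := ge_of_tendsto' hΛ fun n => absRoot_nonneg A n
  have hev : Module.End.HasEigenvalue (Λ : Vec d →ₗ[ℂ] Vec d) 1 := by
    have h1 := CStarAlgebra.norm_mem_spectrum_of_nonneg hΛ0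
    rw [hΛ1, ← spectrum.algebraMap_mem_iff ℂ, map_one] at h1
    exact (mem_spectrum_iff_hasEigenvalue _ _).1 h1
  refine ⟨⟨by simpa using hev, fun r hr => ?_⟩, ?_⟩
  · have h1 := spectrum.norm_le_norm_of_mem ((mem_spectrum_iff_hasEigenvalue _ _).2 hr)
    rw [hΛ1, Complex.norm_real] at h1
    exact (le_abs_self r).trans h1
  by_contra hne
  have h2 : 1 < Module.finrank ℂ (Module.End.eigenspace (Λ : Vec d →ₗ[ℂ] Vec d) 1) := by
    have h3 : Module.finrank ℂ (Module.End.eigenspace (Λ : Vec d →ₗ[ℂ] Vec d) 1) ≠ 0 := fun h =>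
      hev (Submodule.finrank_eq_zero.1 h)
    omega
  -- Room above `exp (-α)` absorbs the constant: `C * exp (-α * n) ≤ δ ^ n` for large `n`.
  obtain ⟨δ, hδ, hδ1⟩ := exists_between (Real.exp_lt_one_iff.2 (neg_neg_of_pos hα))
  have hδ0 : 0 < δ := (Real.exp_pos _).trans hδ
  have hlim : Tendsto (fun n : ℕ => C * (Real.exp (-α) / δ) ^ n) atTop (𝓝 0) := by
    have := (tendsto_pow_atTop_nhds_zero_of_lt_one (by positivity)
      ((div_lt_one hδ0).2 hδ)).const_mul C
    rwa [mul_zero] at this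
  have hdist : Tendsto (fun n => ‖Λ - absRoot A n‖) atTop (𝓝 0) := by
    have := (hΛ.const_sub Λ).norm
    rwa [sub_self, norm_zero] at this
  obtain ⟨n, ⟨hn1, hn2⟩, hn0⟩ := (((hlim.eventually_lt_const zero_lt_one).and
    (hdist.eventually_lt_const (sub_pos.2 hδ1))).and (eventually_ne_atTop 0)).exists
  have hQn : ‖projCompl ψ * A n‖ ≤ δ ^ n := by
    refine (hQ n).trans ?_
    rw [div_pow, ← mul_div_assoc, div_lt_one (by positivity), ← Real.exp_nat_mul, mul_comm (n : ℝ)]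
      at hn1
    exact hn1.le
  obtain ⟨u, hu⟩ := exists_norm_absRoot_apply_le A ψ hn0 hδ0.le hQn
  obtain ⟨v, hvE, hv0, huv⟩ := exists_ne_zero_mem_inner_eq_zero _ h2 u
  have hΛv : Λ v = v := by simpa using Module.End.mem_eigenspace_iff.1 hvE
  have hv : 0 < ‖v‖ := norm_pos_iff.2 hv0
  have h4 : ‖v‖ ≤ ‖Λ - absRoot A n‖ * ‖v‖ + δ * ‖v‖ := by
    calc ‖v‖ = ‖(Λ - absRoot A n) v + absRoot A n v‖ := by simp [hΛv]
      _ ≤ _ := (norm_add_le _ _).trans (add_le_add (ContinuousLinearMap.le_opNorm _ _) (hu v huv))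
  nlinarith

end exponents

end

/-! ### Decay of the products and convergence of `Phi` -/

noncomputable section

section convergence

variable {Ω : Type*} {d : ℕ} {M : Ω → Op d} {ψ : Vec d}

theorem norm_projCompl_mul_le {g : Vec d → ℝ} {a b F : ℝ} (hψ : ‖ψ‖ = 1) (ha : 0 < a) (hb : 0 < b)
    (hF : 0 ≤ F) (hg : ∀ v, a * ‖projCompl ψ v‖ ≤ g v ∧ g v ≤ b * ‖projCompl ψ v‖) {T : Op d}
    (hT : ∀ v, g (T v) ≤ F * g v) : ‖projCompl ψ * T‖ ≤ b / a * F := by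
  refine ContinuousLinearMap.opNorm_le_bound _ (by positivity) fun v => ?_
  refine le_of_mul_le_mul_left ?_ ha
  calc a * ‖projCompl ψ (T v)‖ ≤ g (T v) := (hg _).1
    _ ≤ F * g v := hT v
    _ ≤ F * (b * ‖v‖) := by
      have := (hg v).2.trans (mul_le_mul_of_nonneg_left (norm_projCompl_apply_le hψ v) hb.le)
      gcongr
    _ = a * (b / a * F * ‖v‖) := by field_simp

theorem sub_rankOne_adjoint (ψ : Vec d) (T : Op d) :
    T - InnerProductSpace.rankOne ℂ ψ (ContinuousLinearMap.adjoint T ψ) = projCompl ψ * T := by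
  ext1 v
  simp [projCompl_apply, ContinuousLinearMap.adjoint_inner_left]

/-- The increment of `Phi` is `(M (ω n) - 1) * Phi M ω n`. Its left factor kills `ψ`, so only the
projected, decaying part of `Phi` contributes. -/
theorem norm_adjoint_Phi_sub_le {K : ℝ} (hψ : ‖ψ‖ = 1) (hM : ∀ ω, M ω ψ = ψ)
    (hK : ∀ ω, ‖M ω‖ ≤ K) (ω : ℕ → Ω) (n : ℕ) :
    dist (ContinuousLinearMap.adjoint (Phi M ω n) ψ)
      (ContinuousLinearMap.adjoint (Phi M ω (n + 1)) ψ) ≤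
      (K + 1) * ‖projCompl ψ * Phi M ω n‖ := by
  have h1 : Phi M ω (n + 1) - Phi M ω n = (M (ω n) - 1) * (projCompl ψ * Phi M ω n) := by
    ext1 v
    simp [Phi, projCompl_apply, hM]
  have h2 : ‖M (ω n) - 1‖ ≤ K + 1 :=
    (norm_sub_le _ _).trans (add_le_add (hK _) ContinuousLinearMap.norm_id_le)
  rw [dist_comm, dist_eq_norm, ← sub_apply, ← map_sub, h1]
  refine (ContinuousLinearMap.le_opNorm _ _).trans ?_
  rw [hψ, mul_one, LinearIsometryEquiv.norm_map]
  exact (norm_mul_le _ _).trans (mul_le_mul_of_nonneg_right h2 (norm_nonneg _))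

section rate

variable {K C α : ℝ} {ω : ℕ → Ω}

theorem dist_adjoint_Phi_le_geometric (hψ : ‖ψ‖ = 1) (hM : ∀ ω, M ω ψ = ψ) (hK0 : 0 < K)
    (hK : ∀ ω, ‖M ω‖ ≤ K)
    (hQ : ∀ n : ℕ, ‖projCompl ψ * Phi M ω n‖ ≤ C * Real.exp (-α * n)) (n : ℕ) :
    dist (ContinuousLinearMap.adjoint (Phi M ω n) ψ)
      (ContinuousLinearMap.adjoint (Phi M ω (n + 1)) ψ) ≤
      ((K + 1) * C) * Real.exp (-α) ^ n := by
  refine (norm_adjoint_Phi_sub_le hψ hM hK ω n).trans ?_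
  rw [mul_assoc, ← Real.exp_nat_mul, mul_comm (n : ℝ)]
  exact mul_le_mul_of_nonneg_left (hQ n) (by positivity)

theorem norm_Phi_sub_rankOne_le (hψ : ‖ψ‖ = 1) (hM : ∀ ω, M ω ψ = ψ) (hK0 : 0 < K)
    (hK : ∀ ω, ‖M ω‖ ≤ K) (hα : 0 < α)
    (hQ : ∀ n : ℕ, ‖projCompl ψ * Phi M ω n‖ ≤ C * Real.exp (-α * n)) {η : Vec d}
    (hη : Tendsto (fun n => ContinuousLinearMap.adjoint (Phi M ω n) ψ) atTop (𝓝 η)) (n : ℕ) :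
    ‖Phi M ω n - InnerProductSpace.rankOne ℂ ψ η‖ ≤
      (C + (K + 1) * C / (1 - Real.exp (-α))) * Real.exp (-α * n) := by
  have h1 := dist_le_of_le_geometric_of_tendsto (Real.exp (-α)) _
    (Real.exp_lt_one_iff.2 (neg_neg_of_pos hα))
    (dist_adjoint_Phi_le_geometric hψ hM hK0 hK hQ) hη n
  have h2 : Phi M ω n - InnerProductSpace.rankOne ℂ ψ η = projCompl ψ * Phi M ω n +
      InnerProductSpace.rankOne ℂ ψ (ContinuousLinearMap.adjoint (Phi M ω n) ψ - η) := by
    rw [← sub_rankOne_adjoint, map_sub]; abel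
  rw [h2]
  refine (norm_add_le _ _).trans ?_
  rw [InnerProductSpace.norm_rankOne, hψ, one_mul, ← dist_eq_norm, add_mul]
  refine add_le_add (hQ n) (h1.trans (le_of_eq ?_))
  rw [← Real.exp_nat_mul, mul_comm (n : ℝ), mul_div_right_comm]

end rate

theorem measurable_Phi [MeasurableSpace Ω] (hM : Measurable M) (n : ℕ) :
    Measurable fun ω : ℕ → Ω => Phi M ω n := by
  have : ProperSpace (Op d) := FiniteDimensional.proper ℂ _
  induction n with
  | zero => exact measurable_const
  | succ n ih => exact (hM.comp (measurable_pi_apply n)).mul ih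

theorem exists_ae_norm_projCompl_mul_le [MeasurableSpace Ω] (p : Measure Ω)
    [IsProbabilityMeasure p] (hM : IsRRDO M ψ) (hpos : 0 < p {ω | M ω ∈ ME d}) :
    ∃ α : ℝ, 0 < α ∧ ∀ᵐ ω ∂iidMeasure p, ∃ C : ℝ, 0 < C ∧ ∀ n : ℕ,
      ‖projCompl ψ * Phi M ω n‖ ≤ C * Real.exp (-α * n) ∧
      ‖projCompl ψ * Psi M ω n‖ ≤ C * Real.exp (-α * n) := by
  obtain ⟨g, a, b, k, G, ha, hb, hk, hGm, hpG, hg, hMg, hG⟩ := exists_contracting_set p hM hpos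
  obtain ⟨α, hα, hae⟩ := exists_ae_prod_blockFactor_le_exp p hGm hpG hk
  refine ⟨α, hα, ?_⟩
  filter_upwards [hae] with ω ⟨C, hC, h⟩
  have hle : ∀ n : ℕ, b / a * ∏ j ∈ Finset.range (n / k), blockFactor G k ω j ≤
      (b / a * (C + 1)) * Real.exp (-α * n) := by
    intro n
    rw [mul_assoc]
    refine mul_le_mul_of_nonneg_left ((h n).trans ?_) (by positivity)
    gcongr
    linarith
  have hF : ∀ n : ℕ, 0 ≤ ∏ j ∈ Finset.range (n / k), blockFactor G k ω j := fun n =>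
    Finset.prod_nonneg fun j _ => (blockFactor_pos G k ω j).le
  -- `C` may be 0; adding 1 gives the positive constant whose logarithm is taken for the exponents.
  refine ⟨b / a * (C + 1), by positivity, fun n => ⟨?_, ?_⟩⟩
  · exact (norm_projCompl_mul_le hM.norm_eq_one ha hb (hF n) hg
      (gauge_Phi_le hMg (fun ω hω v => (hG ω hω v).1) ω n)).trans (hle n)
  · exact (norm_projCompl_mul_le hM.norm_eq_one ha hb (hF n) hg
      (gauge_Psi_le hMg (fun ω hω v => (hG ω hω v).2) ω n)).trans (hle n)

end convergence

end

/-! ### The main theorem -/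

theorem theorem3p6 {Ω : Type*} [MeasurableSpace Ω] (p : Measure Ω) [IsProbabilityMeasure p]
    (d : ℕ) (M : Ω → Op d) (ψS : Vec d) (hM : IsRRDO M ψS) (hpos : 0 < p {ω | M ω ∈ ME d}) :
    ∃ α : ℝ, 0 < α ∧ ∃ η : (ℕ → Ω) → Vec d, Measurable η ∧
      ∃ Ω₀ : Set (ℕ → Ω), MeasurableSet Ω₀ ∧ iidMeasure p Ω₀ = 1 ∧ ∀ ω ∈ Ω₀,
        (∃ C : ℝ, ∀ n : ℕ, 1 ≤ n →
          ‖Phi M ω n - InnerProductSpace.rankOne ℂ ψS (η ω)‖ ≤ C * Real.exp (-α * n)) ∧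
        -- the top Lyapunov exponent of `Φ` exists as a limit, is `0`, and has multiplicity one
        (Tendsto (fun n : ℕ => Real.log (singVal (Phi M ω n) 0) / n) atTop (𝓝 0) ∧
          lyapunovExponent (Phi M ω) 0 = 0 ∧ topLyapunovMultiplicity (Phi M ω) = 1) ∧
        -- the same for `Ψ`
        (Tendsto (fun n : ℕ => Real.log (singVal (Psi M ω n) 0) / n) atTop (𝓝 0) ∧
          lyapunovExponent (Psi M ω) 0 = 0 ∧ topLyapunovMultiplicity (Psi M ω) = 1) ∧
        -- in terms of the limit `Λ` of `(Φ_n* Φ_n)^{1/2n}`: `1 = exp 0` is its top eigenvalue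
        -- and is simple
        (∀ Λ : Op d, Tendsto (absRoot (Phi M ω)) atTop (𝓝 Λ) →
          IsGreatest {r : ℝ | Module.End.HasEigenvalue (Λ : Vec d →ₗ[ℂ] Vec d) (r : ℂ)} 1 ∧
          Module.finrank ℂ (Module.End.eigenspace (Λ : Vec d →ₗ[ℂ] Vec d) 1) = 1) := by
  have hψ := hM.norm_eq_one
  obtain ⟨N, hN, hMN⟩ := hM.exists_norm
  obtain ⟨K, hK0, hK⟩ := exists_uniform_norm_bound hψ N hN
  obtain ⟨α, hα, hae⟩ := exists_ae_norm_projCompl_mul_le p hM hpos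
  have hcont : Continuous fun T : Op d => ContinuousLinearMap.adjoint T ψS := by fun_prop
  obtain ⟨η, hηm, hη⟩ := measurable_limit_of_tendsto_metrizable_ae (μ := iidMeasure p)
    (L := atTop) (f := fun (n : ℕ) ω => ContinuousLinearMap.adjoint (Phi M ω n) ψS)
    (fun n => (hcont.measurable.comp (measurable_Phi hM.measurable n)).aemeasurable) (by
      filter_upwards [hae] with ω ⟨C, hC, hQ⟩
      exact cauchySeq_tendsto_of_complete (cauchySeq_of_le_geometric _ _
        (Real.exp_lt_one_iff.2 (neg_neg_of_pos hα)) (dist_adjoint_Phi_le_geometric hψ hM.fixed hK0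
          (fun ω => hK _ (hMN ω)) fun n => (hQ n).1)))
  have hcompl := ae_iff.1 (hae.and hη)
  -- The exceptional set need not be measurable, so its measurable hull, still null, is removed.
  refine ⟨α, hα, η, hηm, (toMeasurable (iidMeasure p) _)ᶜ,
    (measurableSet_toMeasurable _ _).compl, (prob_compl_eq_one_iff
      (measurableSet_toMeasurable _ _)).2 ((measure_toMeasurable _).trans hcompl), fun ω hω => ?_⟩
  obtain ⟨⟨C, hC, hQ⟩, hηω⟩ := not_not.1 fun h => hω (subset_toMeasurable _ _ h)
  have hPhi : ∀ n, ‖Phi M ω n‖ ≤ K := fun n => hK _ (Phi_gauge_le hMN ω n)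
  have hPsi : ∀ n, ‖Psi M ω n‖ ≤ K := fun n => hK _ (Psi_gauge_le hMN ω n)
  have hPhiψ := Phi_fixed hM.fixed ω
  have hPsiψ := Psi_fixed hM.fixed ω
  have hQPhi := fun n => (hQ n).1
  have hQPsi := fun n => (hQ n).2
  exact ⟨⟨_, fun n _ => norm_Phi_sub_rankOne_le hψ hM.fixed hK0 (fun ω => hK _ (hMN ω)) hα hQPhi
      hηω n⟩,
    ⟨tendsto_log_singVal_zero hψ hPhiψ hPhi, lyapunovExponent_zero_eq hψ hPhiψ hPhi,
      topLyapunovMultiplicity_eq_one hψ hPhiψ hPhi hC hα hQPhi⟩,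
    ⟨tendsto_log_singVal_zero hψ hPsiψ hPsi, lyapunovExponent_zero_eq hψ hPsiψ hPsi,
      topLyapunovMultiplicity_eq_one hψ hPsiψ hPsi hC hα hQPsi⟩,
    fun Λ hΛ => eigen_limit_absRoot hψ hPhiψ hPhi hα hQPhi hΛ⟩
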